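/- Let $n,k\ge 1$. An $n\times k$ indicator matrix is a real matrix $X$ that encodes a partition of $n$ points into $k$ non-empty clusters: $X_{ij}=1/\sqrt{z_j}$ if point $i$ belongs to cluster $j$ and $X_{ij}=0$ otherwise, where $z_j\ge 1$ is the size of cluster $j$ and every point belongs to exactly one cluster (so $X^\top X=I_k$). The $k$-means cost of $X$ on a matrix $B\in\mathbb{R}^{n\times m}$, whose rows are the points, is $\|B-XX^\top B\|_F^2$; $X$ is optimal for $B$ if it minimizes this cost among all $n\times k$ indicator matrices. For $\gamma\ge 1$ and $\delta_\gamma\in[0,1)$, a $\gamma$-approximation $k$-means algorithm with failure probability $\delta_\gamma$ is a randomized algorithm that on every input $B$ returns an $n\times k$ indicator matrix $X$ such that, with probability at least $1-\delta_\gamma$ over its own randomness, $\|B-XX^\top B\|_F^2\le\gamma\min_{Y}\|B-YY^\top B\|_F^2$, the minimum being over all $n\times k$ indicator matrices $Y$. **Theorem.** There is an absolute constant $c>0$ such that the following holds for every $A\in\mathbb{R}^{n\times d}$, every positive integer $k<\min\{n,d\}$, every $\varepsilon\in(0,1/3)$ and every integer $t\ge ck/\varepsilon^2$. Let $R$ be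 a random $d\times t$ matrix with independent entries, each equal to $+1/\sqrt t$ or $-1/\sqrt t$ with probability $1/2$. 1. Let $\gamma\ge1$ and $\delta_\gamma\in[0,1)$, let $X_{\mathrm{opt}}$ be optimal for $A$, and let $X$ be the indicator matrix returned by a $\gamma$-approximation $k$-means algorithm with failure probability $\delta_\gamma$, run (with randomness independent of $R$) on $AR$. Then, with probability at least $0.97-\delta_\gamma$, $$\|A-XX^\top A\|_F^2\le\bigl(1+(1+\varepsilon)\gamma\bigr)\,\|A-X_{\mathrm{opt}}X_{\mathrm{opt}}^\top A\|_F^2 .$$ 2. In particular, with probability at least $0.97$ over $R$, every indicator matrix $X$ that is optimal for $AR$ satisfies $\|A-XX^\top A\|_F^2\le(2+\varepsilon)\,\|A-X_{\mathrm{opt}}X_{\mathrm{opt}}^\top A\|_F^2$ for every $X_{\mathrm{opt}}$ that is optimal for $A$. -/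

import Mathlib

open Matrix

noncomputable section

namespace KMeansRP

/-- The points (rows) that belong to the `j`-th cluster of `X`. -/
def cluster {n k : ℕ} (X : Matrix (Fin n) (Fin k) ℝ) (j : Fin k) : Set (Fin n) :=
  {i | X i j ≠ 0}

/-- `n × k` (normalized) cluster indicator matrices: every row has exactly one non-zero entry, the
non-zero entries of column `j` are `1 / √z_j`, where `z_j` is the size of the `j`-th cluster, and no
cluster is empty, so that `Xᵀ * X = 1`. -/
structure IsIndicator {n k : ℕ} (X : Matrix (Fin n) (Fin k) ℝ) : Prop where
  existsUnique_ne_zero : ∀ i, ∃! j, X i j ≠ 0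
  entry_eq : ∀ i j, X i j ≠ 0 → X i j = 1 / √((cluster X j).ncard : ℝ)
  cluster_nonempty : ∀ j, (cluster X j).Nonempty

/-- The set of all `n × k` indicator matrices. -/
abbrev Indicator (n k : ℕ) : Type := {X : Matrix (Fin n) (Fin k) ℝ // IsIndicator X}

section Cost

attribute [local instance] Matrix.frobeniusNormedAddCommGroup

/-- The `k`-means objective `F(A, X) = ‖A - X Xᵀ A‖_F²` (Frobenius norm). -/
def cost {n m k : ℕ} (A : Matrix (Fin n) (Fin m) ℝ) (X : Indicator n k) : ℝ :=
  ‖A - X.1 * X.1ᵀ * A‖ ^ 2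

end Cost

/-- `X` is an optimal `k`-means clustering of the rows of `A`. -/
def IsOptimal {n m k : ℕ} (A : Matrix (Fin n) (Fin m) ℝ) (X : Indicator n k) : Prop :=
  ∀ Y : Indicator n k, cost A X ≤ cost A Y

/-- The probability of the event `S` under the discrete law `p`, as a real number. -/
def prob {α : Type*} (p : PMF α) (S : Set α) : ℝ := (p.toOuterMeasure S).toReal

/-- A randomized clustering algorithm on `n` points in `m` dimensions with `k` clusters: to each
input it assigns the law of the indicator matrix that it returns. -/
abbrev Algorithm (n m k : ℕ) : Type := Matrix (Fin n) (Fin m) ℝ → PMF (Indicator n k)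

/-- On every input, with probability at least `1 - δ` over its own randomness, the algorithm returns
a clustering whose cost is at most `γ` times the minimal cost. -/
def IsApproximation {n m k : ℕ} (alg : Algorithm n m k) (γ δ : ℝ) : Prop :=
  ∀ B : Matrix (Fin n) (Fin m) ℝ,
    1 - δ ≤ prob (alg B) {X | ∀ Y : Indicator n k, cost B X ≤ γ * cost B Y}

/-- The law of a random `d × t` matrix with independent entries, each of them `+1/√t` or `-1/√t`
with probability `1/2`; that is, all `2 ^ (d * t)` sign patterns are equally likely. -/
def signMatrix (d t : ℕ) : PMF (Matrix (Fin d) (Fin t) ℝ) :=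
  (PMF.uniformOfFintype (Fin d → Fin t → Bool)).map
    fun s => Matrix.of fun i j => if s i j then 1 / √(t : ℝ) else -(1 / √(t : ℝ))

/-- The random projection algorithm: draw a random `d × t` sign matrix `R`, then run `alg` (with
fresh randomness) on `A * R`. This is the law of the returned indicator matrix. -/
def projectAndCluster {n d t k : ℕ} (alg : Algorithm n t k) (A : Matrix (Fin n) (Fin d) ℝ) :
    PMF (Indicator n k) :=
  (signMatrix d t).bind fun R => alg (A * R)

/-- Replacing the rows of `A` by those of `B` preserves the `k`-clustering structure within a factor
`φ`: every optimal clustering of `B` is, as a clustering of `A`, at most a factor `φ` worse than an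
optimal clustering of `A`. -/
def PreservesClustering {n d m : ℕ} (k : ℕ) (A : Matrix (Fin n) (Fin d) ℝ)
    (B : Matrix (Fin n) (Fin m) ℝ) (φ : ℝ) : Prop :=
  ∀ X Xopt : Indicator n k, IsOptimal B X → IsOptimal A Xopt → cost A X ≤ φ * cost A Xopt

end KMeansRP

end

/-!
Fix a reference clustering `Y` of the rows `a` of `A`, and let `V` be the span of its at most `k`
centroids. The cost of a clustering `X` is the squared norm of `M a`, where `M = 1 - X Xᵀ` is an
orthogonal projection, and it splits into the parts of `M a` outside and inside `V`. The part
outside `V` is `M` applied to the part of `a` outside `V`, so it costs at most as much as `Y`.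

For the part inside `V`, three properties of the sketch `x ↦ x R` suffice, each of which holds with
probability at least `0.99`: it nearly preserves norms on `V` (subexponential tails and a union
bound over a net of the unit ball), it does not increase the cost of `Y` by more than a factor
`1 + O(ε)`, and it nearly preserves the orthogonality between `V` and the part of `a` outside `V`
(second moments). So the part inside `V` has nearly the norm of its sketch, which is bounded in
terms of the sketched cost of `X`, hence by `(1 + ε) γ` times the cost of `Y`.
-/

open Finset
open scoped BigOperators RealInnerProductSpace Matrix.Module

namespace KMeansRP

/-! ### Discrete laws -/

section Laws

variable {α β : Type*}

lemma prob_eq_measureReal [MeasurableSpace α] [DiscreteMeasurableSpace α] (p : PMF α)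
    (S : Set α) : prob p S = p.toMeasure.real S := by
  rw [prob, MeasureTheory.measureReal_def, p.toMeasure_apply_eq_toOuterMeasure]

lemma prob_univ (p : PMF α) : prob p Set.univ = 1 := by
  let _ : MeasurableSpace α := ⊤
  rw [prob_eq_measureReal, MeasureTheory.probReal_univ]

lemma prob_mono (p : PMF α) {S T : Set α} (h : S ⊆ T) : prob p S ≤ prob p T := by
  let _ : MeasurableSpace α := ⊤
  simpa only [prob_eq_measureReal] using MeasureTheory.measureReal_mono h

lemma prob_union_le (p : PMF α) (S T : Set α) : prob p (S ∪ T) ≤ prob p S + prob p T := by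
  let _ : MeasurableSpace α := ⊤
  simpa only [prob_eq_measureReal] using MeasureTheory.measureReal_union_le S T

lemma prob_biUnion_le (p : PMF α) (s : Finset β) (S : β → Set α) :
    prob p (⋃ b ∈ s, S b) ≤ ∑ b ∈ s, prob p (S b) := by
  let _ : MeasurableSpace α := ⊤
  simpa only [prob_eq_measureReal] using MeasureTheory.measureReal_biUnion_finset_le s S

lemma prob_compl (p : PMF α) (S : Set α) : prob p Sᶜ = 1 - prob p S := by
  let _ : MeasurableSpace α := ⊤
  simpa only [prob_eq_measureReal] using
    MeasureTheory.probReal_compl_eq_one_sub (MeasurableSet.of_discrete (s := S))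

lemma prob_map (p : PMF α) (f : α → β) (S : Set β) : prob (p.map f) S = prob p (f ⁻¹' S) := by
  rw [prob, prob, PMF.toOuterMeasure_map_apply]

lemma mul_prob_le_prob_bind (p : PMF α) (f : α → PMF β) {G : Set α} {T : Set β} {q : ℝ}
    (h : ∀ a ∈ G, q ≤ prob (f a) T) : q * prob p G ≤ prob (p.bind f) T := by
  have hle : ENNReal.ofReal q * p.toOuterMeasure G ≤ (p.bind f).toOuterMeasure T := by
    rw [PMF.toOuterMeasure_bind_apply, PMF.toOuterMeasure_apply, ← ENNReal.tsum_mul_left]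
    refine ENNReal.tsum_le_tsum fun a => ?_
    by_cases ha : a ∈ G
    · rw [Set.indicator_of_mem ha, mul_comm]
      gcongr
      exact ENNReal.ofReal_le_of_le_toReal (h a ha)
    · simp only [Set.indicator_of_notMem ha, mul_zero, zero_le]
  have hne : (p.bind f).toOuterMeasure T ≠ ⊤ := by
    let _ : MeasurableSpace β := ⊤
    rw [← (p.bind f).toMeasure_apply_eq_toOuterMeasure]
    exact MeasureTheory.measure_ne_top _ _
  calc q * prob p G ≤ max q 0 * prob p G :=
        mul_le_mul_of_nonneg_right (le_max_left _ _) ENNReal.toReal_nonneg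
    _ ≤ prob (p.bind f) T := by
        rw [prob, ← ENNReal.toReal_ofReal', ← ENNReal.toReal_mul]
        exact ENNReal.toReal_mono hne hle

end Laws

/-! ### Expectations over finite probability spaces -/

section Expectation

variable {Ω : Type*} [Fintype Ω]

lemma expect_sum_sq_le {ι : Type*} [Fintype ι] {f : ι → Ω → ℝ} {w : ι → ℝ} {κ : ℝ} (hκ : 0 ≤ κ)
    (hw : ∀ i, 0 ≤ w i) (h : ∀ i, 𝔼 ω, f i ω ^ 2 ≤ κ * w i ^ 2) :
    𝔼 ω, (∑ i, f i ω) ^ 2 ≤ κ * (∑ i, w i) ^ 2 := by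
  have hpair : ∀ i j, 𝔼 ω, f i ω * f j ω ≤ κ * (w i * w j) := fun i j => by
    refine le_of_sq_le_sq ?_ (mul_nonneg hκ (mul_nonneg (hw i) (hw j)))
    calc (𝔼 ω, f i ω * f j ω) ^ 2 ≤ (𝔼 ω, f i ω ^ 2) * 𝔼 ω, f j ω ^ 2 :=
          expect_mul_sq_le_sq_mul_sq _ _ _
      _ ≤ κ * w i ^ 2 * (κ * w j ^ 2) :=
          mul_le_mul (h i) (h j) (expect_nonneg fun ω _ => sq_nonneg _)
            (mul_nonneg hκ (sq_nonneg _))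
      _ = (κ * (w i * w j)) ^ 2 := by ring
  calc 𝔼 ω, (∑ i, f i ω) ^ 2 = ∑ i, ∑ j, 𝔼 ω, f i ω * f j ω := by
        simp only [sq, sum_mul_sum, expect_sum_comm]
    _ ≤ ∑ i, ∑ j, κ * (w i * w j) := by
        gcongr with i _ j _
        exact hpair i j
    _ = κ * (∑ i, w i) ^ 2 := by rw [sq, sum_mul_sum]; simp only [mul_sum]

lemma expect_prod_pi {ι κ : Type*} [Fintype ι] [Fintype κ] [DecidableEq ι] (f : ι → κ → ℝ) :
    𝔼 s : ι → κ, ∏ i, f i (s i) = ∏ i, 𝔼 b, f i b := by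
  simp only [Fintype.expect_eq_sum_div_card, prod_div_distrib, prod_univ_sum,
    Fintype.piFinset_univ, Fintype.card_fun, prod_const, card_univ, Nat.cast_pow]

variable [Nonempty Ω]

lemma prob_uniformOfFintype (S : Set Ω) :
    prob (PMF.uniformOfFintype Ω) S = 𝔼 ω, S.indicator (1 : Ω → ℝ) ω := by
  classical
  rw [prob, PMF.toOuterMeasure_uniformOfFintype_apply, ENNReal.toReal_div, ENNReal.toReal_natCast,
    ENNReal.toReal_natCast, Fintype.expect_eq_sum_div_card, Fintype.card_subtype]
  simp only [Set.indicator_apply, Pi.one_apply, sum_boole]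

lemma prob_lt_le_of_expect_le {f : Ω → ℝ} (hf : ∀ ω, 0 ≤ f ω) {a κ : ℝ} (ha : 0 ≤ a) (hκ : 0 ≤ κ)
    (h : 𝔼 ω, f ω ≤ κ * a) : prob (PMF.uniformOfFintype Ω) {ω | a < f ω} ≤ κ := by
  rw [prob_uniformOfFintype]
  rcases ha.eq_or_lt with rfl | ha
  · have hzero : ∀ ω, f ω = 0 := by
      rw [mul_zero] at h
      have := (expect_eq_zero_iff_of_nonneg fun ω _ => hf ω).1
        (h.antisymm (expect_nonneg fun ω _ => hf ω))
      exact fun ω => this ω (mem_univ ω)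
    simpa [hzero] using hκ
  · refine le_trans ?_ ((div_le_iff₀ ha).2 h)
    rw [expect_div]
    refine expect_le_expect fun ω _ => Set.indicator_apply_le' (fun hω => ?_) fun _ => ?_
    · exact (one_le_div ha).2 hω.le
    · exact div_nonneg (hf ω) ha.le

lemma exp_le_one_add_add_sq_mul_exp_abs (u : ℝ) :
    Real.exp u ≤ 1 + u + u ^ 2 * Real.exp |u| := by
  rcases le_or_gt |u| 1 with hu | hu
  · have hbound := (abs_le.1 (Real.abs_exp_sub_one_sub_id_le hu)).2
    have hsq : u ^ 2 ≤ u ^ 2 * Real.exp |u| :=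
      le_mul_of_one_le_right (sq_nonneg u) (Real.one_le_exp (abs_nonneg u))
    linarith
  · have hsq : Real.exp |u| ≤ u ^ 2 * Real.exp |u| :=
      le_mul_of_one_le_left (Real.exp_pos _).le ((one_lt_sq_iff_one_lt_abs u).2 hu).le
    rcases abs_choice u with h | h
    · rw [h] at hu hsq ⊢
      linarith
    · have hneg : Real.exp u ≤ 1 := Real.exp_le_one_iff.2 (by linarith)
      linarith [Real.add_one_le_exp |u|]

lemma sq_le_eight_mul_exp_abs_div_two (z : ℝ) : z ^ 2 ≤ 8 * Real.exp (|z| / 2) := by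
  have h := Real.quadratic_le_exp_of_nonneg (x := |z| / 2) (by positivity)
  rw [div_pow, sq_abs] at h
  linarith [abs_nonneg z]

lemma exp_mul_le_one_add_add_mul_exp_abs (z : ℝ) {r : ℝ} (hr : |r| ≤ 1 / 2) :
    Real.exp (r * z) ≤ 1 + r * z + 8 * r ^ 2 * Real.exp |z| := by
  have habs : |r * z| ≤ |z| / 2 := by
    rw [abs_mul]
    nlinarith [abs_nonneg z]
  calc Real.exp (r * z) ≤ 1 + r * z + (r * z) ^ 2 * Real.exp |r * z| :=
        exp_le_one_add_add_sq_mul_exp_abs _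
    _ ≤ 1 + r * z + r ^ 2 * (8 * Real.exp (|z| / 2)) * Real.exp (|z| / 2) := by
        rw [mul_pow]
        gcongr
        exact sq_le_eight_mul_exp_abs_div_two z
    _ = 1 + r * z + 8 * r ^ 2 * Real.exp |z| := by
        rw [← add_halves |z|, Real.exp_add, add_halves]
        ring

lemma expect_exp_mul_le {Z : Ω → ℝ} (hZ : 𝔼 ω, Z ω = 0) {K : ℝ}
    (hK : 𝔼 ω, Real.exp |Z ω| ≤ K) {r : ℝ} (hr : |r| ≤ 1 / 2) :
    𝔼 ω, Real.exp (r * Z ω) ≤ Real.exp (8 * K * r ^ 2) := by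
  calc 𝔼 ω, Real.exp (r * Z ω) ≤ 𝔼 ω, (1 + r * Z ω + 8 * r ^ 2 * Real.exp |Z ω|) :=
        expect_le_expect fun ω _ => exp_mul_le_one_add_add_mul_exp_abs (Z ω) hr
    _ = 1 + 8 * r ^ 2 * 𝔼 ω, Real.exp |Z ω| := by
        rw [expect_add_distrib, expect_add_distrib, ← mul_expect, ← mul_expect, hZ,
          Fintype.expect_const, mul_zero, add_zero]
    _ ≤ 8 * K * r ^ 2 + 1 := by nlinarith [mul_le_mul_of_nonneg_left hK (sq_nonneg r)]
    _ ≤ Real.exp (8 * K * r ^ 2) := Real.add_one_le_exp _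

lemma sq_le_two_mul_exp_add_exp_neg (z : ℝ) : z ^ 2 ≤ 2 * (Real.exp z + Real.exp (-z)) := by
  have h := Real.quadratic_le_exp_of_nonneg (abs_nonneg z)
  rw [sq_abs] at h
  have h' : Real.exp |z| ≤ Real.exp z + Real.exp (-z) := by
    rcases abs_choice z with hz | hz <;> rw [hz] <;> linarith [Real.exp_pos z, Real.exp_pos (-z)]
  linarith [abs_nonneg z]

end Expectation

/-! ### Rademacher sums -/

section Rademacher

variable {ι : Type*} [Fintype ι]

/-- The sign `1` or `-1` encoded by a Boolean; uniform Booleans give Rademacher variables. -/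
def sign (b : Bool) : ℝ := if b then 1 else -1

/-- The Rademacher sum `∑ i, ± x i` of the coordinates of `x`, with the signs given by `s`. -/
def signedSum (x : EuclideanSpace ℝ ι) (s : ι → Bool) : ℝ := ∑ i, x i * sign (s i)

/-- The product of two Rademacher sums with the same signs, minus its expectation `⟪x, y⟫`. -/
noncomputable def centeredProd (x y : EuclideanSpace ℝ ι) (s : ι → Bool) : ℝ :=
  signedSum x s * signedSum y s - ⟪x, y⟫

lemma expect_bool (f : Bool → ℝ) : 𝔼 b, f b = (f true + f false) / 2 := by
  rw [Fintype.expect_eq_sum_div_card, Fintype.sum_bool, Fintype.card_bool, Nat.cast_ofNat]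

lemma abs_centeredProd_le {x y : EuclideanSpace ℝ ι} (hx : ‖x‖ ≤ 1) (hy : ‖y‖ ≤ 1)
    (s : ι → Bool) :
    |centeredProd x y s| ≤ 1 + (signedSum x s ^ 2 + signedSum y s ^ 2) / 2 := by
  have hinner : |⟪x, y⟫| ≤ 1 :=
    (abs_real_inner_le_norm x y).trans (mul_le_one₀ hx (norm_nonneg y) hy)
  have hprod : |signedSum x s * signedSum y s| ≤ (signedSum x s ^ 2 + signedSum y s ^ 2) / 2 := by
    rw [abs_mul, ← sq_abs (signedSum x s), ← sq_abs (signedSum y s)]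
    linarith [two_mul_le_add_sq |signedSum x s| |signedSum y s|]
  exact (abs_sub _ _).trans (by linarith)

lemma exp_abs_centeredProd_div_four_le {x y : EuclideanSpace ℝ ι} (hx : ‖x‖ ≤ 1) (hy : ‖y‖ ≤ 1)
    (s : ι → Bool) :
    Real.exp |centeredProd x y s / 4| ≤
      2 / 3 * (Real.exp (signedSum x s ^ 2 / 4) + Real.exp (signedSum y s ^ 2 / 4)) := by
  set p := Real.exp (signedSum x s ^ 2 / 8) with hp
  set q := Real.exp (signedSum y s ^ 2 / 8) with hq
  have hquarter : Real.exp (1 / 4) ≤ 4 / 3 := by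
    have h := Real.exp_bound_div_one_sub_of_interval (x := 1 / 4) (by norm_num) (by norm_num)
    norm_num at h ⊢
    exact h
  have hp2 : Real.exp (signedSum x s ^ 2 / 4) = p ^ 2 := by
    rw [hp, ← Real.exp_nat_mul]
    ring_nf
  have hq2 : Real.exp (signedSum y s ^ 2 / 4) = q ^ 2 := by
    rw [hq, ← Real.exp_nat_mul]
    ring_nf
  calc Real.exp |centeredProd x y s / 4| ≤ Real.exp (1 / 4) * (p * q) := by
        rw [hp, hq, ← Real.exp_add, ← Real.exp_add, Real.exp_le_exp, abs_div,
          abs_of_pos (four_pos (α := ℝ))]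
        linarith [abs_centeredProd_le hx hy s]
    _ ≤ 4 / 3 * (p * q) := by gcongr
    _ ≤ 2 / 3 * (p ^ 2 + q ^ 2) := by linarith [two_mul_le_add_sq p q]
    _ = _ := by rw [hp2, hq2]

open MeasureTheory in
lemma integrable_exp_linear_sub_sq (a : ℝ) :
    Integrable fun g : ℝ => Real.exp (a * g - g ^ 2 / 2) := by
  have h := (integrable_exp_neg_mul_sq one_half_pos).comp_sub_right a |>.const_mul
    (Real.exp (a ^ 2 / 2))
  refine h.congr (Filter.Eventually.of_forall fun g => ?_)
  simp only [← Real.exp_add]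
  ring_nf

lemma integral_exp_linear_sub_sq (a : ℝ) :
    ∫ g : ℝ, Real.exp (a * g - g ^ 2 / 2) = Real.exp (a ^ 2 / 2) * √(2 * Real.pi) := by
  have h : ∀ g : ℝ, Real.exp (a * g - g ^ 2 / 2) =
      Real.exp (a ^ 2 / 2) * Real.exp (-(1 / 2) * (g - a) ^ 2) := fun g => by
    rw [← Real.exp_add]
    ring_nf
  simp only [h]
  rw [MeasureTheory.integral_const_mul,
    MeasureTheory.integral_sub_right_eq_self fun g => Real.exp (-(1 / 2) * g ^ 2),
    integral_gaussian, div_div_eq_mul_div, div_one, mul_comm Real.pi]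

variable [DecidableEq ι]

lemma expect_sign_mul_sign (i j : ι) :
    𝔼 s : ι → Bool, sign (s i) * sign (s j) = if i = j then 1 else 0 := by
  have h : ∀ s : ι → Bool, sign (s i) * sign (s j) =
      ∏ l, (if l = i then sign (s l) else 1) * (if l = j then sign (s l) else 1) := fun s => by
    simp only [prod_mul_distrib, prod_ite_eq', mem_univ, if_true]
  simp only [h]
  rw [expect_prod_pi fun l b => (if l = i then sign b else 1) * (if l = j then sign b else 1)]
  split_ifs with hij
  · subst hij
    refine prod_eq_one fun l _ => ?_
    rw [expect_bool]
    by_cases hl : l = i <;> simp [hl, sign]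
  · refine prod_eq_zero (mem_univ i) ?_
    rw [expect_bool]
    simp [hij, sign]

lemma expect_signedSum_mul_signedSum (x y : EuclideanSpace ℝ ι) :
    𝔼 s, signedSum x s * signedSum y s = ⟪x, y⟫ := by
  have h : ∀ s : ι → Bool, signedSum x s * signedSum y s =
      ∑ i, ∑ j, x i * y j * (sign (s i) * sign (s j)) := fun s => by
    rw [signedSum, signedSum, sum_mul_sum]
    exact sum_congr rfl fun i _ => sum_congr rfl fun j _ => by ring
  simp only [h, expect_sum_comm, ← mul_expect, expect_sign_mul_sign, mul_ite, mul_one, mul_zero,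
    sum_ite_eq, mem_univ, if_true, PiLp.inner_apply, RCLike.inner_apply, conj_trivial]
  exact sum_congr rfl fun i _ => mul_comm _ _

lemma expect_centeredProd (x y : EuclideanSpace ℝ ι) : 𝔼 s, centeredProd x y s = 0 := by
  simp only [centeredProd, expect_sub_distrib, expect_signedSum_mul_signedSum,
    Fintype.expect_const, sub_self]

lemma expect_exp_mul_signedSum_le (x : EuclideanSpace ℝ ι) (r : ℝ) :
    𝔼 s, Real.exp (r * signedSum x s) ≤ Real.exp (r ^ 2 * ‖x‖ ^ 2 / 2) := by
  have h : ∀ s : ι → Bool, Real.exp (r * signedSum x s) =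
      ∏ i, Real.exp (r * (x i * sign (s i))) := fun s => by
    rw [signedSum, mul_sum, Real.exp_sum]
  simp only [h]
  rw [expect_prod_pi fun i b => Real.exp (r * (x i * sign b)), EuclideanSpace.real_norm_sq_eq,
    mul_sum, sum_div, Real.exp_sum]
  refine prod_le_prod (fun i _ => expect_nonneg fun b _ => (Real.exp_pos _).le) fun i _ => ?_
  calc 𝔼 b, Real.exp (r * (x i * sign b)) = Real.cosh (r * x i) := by
        rw [expect_bool, Real.cosh_eq]
        simp only [sign, if_true, mul_one, Bool.false_eq_true, if_false, mul_neg]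
    _ ≤ Real.exp (r ^ 2 * x i ^ 2 / 2) := by
        rw [← mul_pow]
        exact Real.cosh_le_exp_half_sq _

lemma expect_exp_linear_sub_sq_le {x : EuclideanSpace ℝ ι} (hx : ‖x‖ ≤ 1) (g : ℝ) :
    𝔼 s, Real.exp (1 / √2 * signedSum x s * g - g ^ 2 / 2) ≤ Real.exp (-(1 / 4) * g ^ 2) := by
  have hnorm : ‖x‖ ^ 2 ≤ 1 := pow_le_one₀ (norm_nonneg x) hx
  have h : ∀ s : ι → Bool, Real.exp (1 / √2 * signedSum x s * g - g ^ 2 / 2) =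
      Real.exp (1 / √2 * g * signedSum x s) * Real.exp (-(g ^ 2 / 2)) := fun s => by
    rw [← Real.exp_add]
    ring_nf
  calc 𝔼 s, Real.exp (1 / √2 * signedSum x s * g - g ^ 2 / 2)
      ≤ Real.exp ((1 / √2 * g) ^ 2 * ‖x‖ ^ 2 / 2) * Real.exp (-(g ^ 2 / 2)) := by
        simp only [h]
        rw [← expect_mul]
        gcongr
        exact expect_exp_mul_signedSum_le x _
    _ ≤ Real.exp (-(1 / 4) * g ^ 2) := by
        rw [← Real.exp_add, Real.exp_le_exp, mul_pow, div_pow, Real.sq_sqrt zero_le_two]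
        nlinarith [mul_le_mul_of_nonneg_left hnorm (sq_nonneg g)]

open MeasureTheory in
/- `exp (S² / 4) = 𝔼 exp (S g / √2)` for a standard Gaussian `g`, which is linear in `S` in the
exponent; exchanging the two expectations reduces the claim to the Laplace transform of `S`. -/
lemma expect_exp_signedSum_sq_div_four_le {x : EuclideanSpace ℝ ι} (hx : ‖x‖ ≤ 1) :
    𝔼 s, Real.exp (signedSum x s ^ 2 / 4) ≤ √2 := by
  have hgauss : ∀ s, Real.exp (signedSum x s ^ 2 / 4) * √(2 * Real.pi) =
      ∫ g : ℝ, Real.exp (1 / √2 * signedSum x s * g - g ^ 2 / 2) := fun s => by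
    rw [integral_exp_linear_sub_sq, mul_pow, div_pow, Real.sq_sqrt zero_le_two]
    ring_nf
  have hint : ∀ s ∈ univ, Integrable fun g : ℝ =>
      Real.exp (1 / √2 * signedSum x s * g - g ^ 2 / 2) := fun s _ => integrable_exp_linear_sub_sq _
  refine le_of_mul_le_mul_right ?_ (show 0 < √(2 * Real.pi) by positivity)
  calc (𝔼 s, Real.exp (signedSum x s ^ 2 / 4)) * √(2 * Real.pi)
      = ∫ g : ℝ, 𝔼 s, Real.exp (1 / √2 * signedSum x s * g - g ^ 2 / 2) := by
        rw [expect_mul]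
        simp only [hgauss, Fintype.expect_eq_sum_div_card]
        rw [integral_div, integral_finsetSum _ hint]
    _ ≤ ∫ g : ℝ, Real.exp (-(1 / 4) * g ^ 2) := by
        refine integral_mono ?_ (integrable_exp_neg_mul_sq (by norm_num)) fun g =>
          expect_exp_linear_sub_sq_le hx g
        simp only [Fintype.expect_eq_sum_div_card]
        exact (integrable_finsetSum _ hint).div_const _
    _ = √2 * √(2 * Real.pi) := by
        rw [integral_gaussian, ← Real.sqrt_mul zero_le_two]
        ring_nf

lemma expect_exp_abs_centeredProd_div_four_le {x y : EuclideanSpace ℝ ι} (hx : ‖x‖ ≤ 1)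
    (hy : ‖y‖ ≤ 1) : 𝔼 s, Real.exp |centeredProd x y s / 4| ≤ 2 := by
  have hsqrt : √2 ≤ 1.5 := Real.sqrt_le_iff.2 (by norm_num)
  calc 𝔼 s, Real.exp |centeredProd x y s / 4|
      ≤ 𝔼 s, 2 / 3 * (Real.exp (signedSum x s ^ 2 / 4) + Real.exp (signedSum y s ^ 2 / 4)) :=
        expect_le_expect fun s _ => exp_abs_centeredProd_div_four_le hx hy s
    _ ≤ 2 / 3 * (√2 + √2) := by
        rw [← mul_expect, expect_add_distrib]
        gcongr <;> exact expect_exp_signedSum_sq_div_four_le ‹_›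
    _ ≤ 2 := by linarith

lemma expect_exp_mul_centeredProd_le {x y : EuclideanSpace ℝ ι} (hx : ‖x‖ ≤ 1) (hy : ‖y‖ ≤ 1)
    {r : ℝ} (hr : |r| ≤ 1 / 8) :
    𝔼 s, Real.exp (r * centeredProd x y s) ≤ Real.exp (256 * r ^ 2) := by
  have hmean : 𝔼 s, centeredProd x y s / 4 = 0 := by
    rw [← expect_div, expect_centeredProd, zero_div]
  have h := expect_exp_mul_le hmean (expect_exp_abs_centeredProd_div_four_le hx hy) (r := 4 * r)
    (by rw [abs_mul, abs_of_pos four_pos]; linarith)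
  ring_nf at h ⊢
  exact h

end Rademacher

/-! ### Nets and operator norms -/

section Net

open Metric

variable {E F : Type*} [NormedAddCommGroup E] [NormedSpace ℝ E] [NormedAddCommGroup F]
  [NormedSpace ℝ F]

lemma card_le_of_isSeparated_half [FiniteDimensional ℝ E] {s : Finset E}
    (hs : (s : Set E) ⊆ closedBall 0 1) (hsep : IsSeparated (2⁻¹ : NNReal) (s : Set E)) :
    s.card ≤ 5 ^ Module.finrank ℝ E := by
  classical
  rw [← card_image_of_injective s (smul_right_injective E (two_ne_zero (α := ℝ)))]
  refine Besicovitch.card_le_of_separated _ (forall_mem_image.2 fun c hc => ?_)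
    (forall_mem_image.2 fun c hc => forall_mem_image.2 fun d hd hcd => ?_)
  · rw [norm_smul, Real.norm_two]
    linarith [mem_closedBall_zero_iff.1 (hs hc)]
  · have h : ((2⁻¹ : NNReal) : ENNReal) < edist c d := hsep hc hd (ne_of_apply_ne _ hcd)
    rw [edist_nndist, ENNReal.coe_lt_coe, ← NNReal.coe_lt_coe, coe_nndist, dist_eq_norm] at h
    rw [← smul_sub, norm_smul, Real.norm_two]
    push_cast at h
    linarith

variable (E) in
lemma packingNumber_half_closedBall_le [FiniteDimensional ℝ E] :
    packingNumber 2⁻¹ (closedBall (0 : E) 1) ≤ 5 ^ Module.finrank ℝ E := by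
  refine iSup_le fun C => iSup_le fun hC => iSup_le fun hsep => ?_
  by_contra! hlt
  obtain ⟨D, hDC, hD⟩ := Set.exists_subset_encard_eq (Order.add_one_le_of_lt hlt)
  have hfin : D.Finite := Set.finite_of_encard_eq_coe (by rw [hD]; norm_cast)
  lift D to Finset E using hfin
  have hcard := card_le_of_isSeparated_half (hDC.trans hC) (hsep.subset hDC)
  rw [Set.encard_coe_eq_coe_finsetCard] at hD
  norm_cast at hD
  omega

variable (E) in
lemma exists_isCover_closedBall_card_le [FiniteDimensional ℝ E] :
    ∃ N : Finset E, N.card ≤ 5 ^ Module.finrank ℝ E ∧ (N : Set E) ⊆ closedBall 0 1 ∧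
      IsCover 2⁻¹ (closedBall (0 : E) 1) (N : Set E) := by
  have hle := (coveringNumber_le_packingNumber _ _).trans (packingNumber_half_closedBall_le E)
  have htop : coveringNumber 2⁻¹ (closedBall (0 : E) 1) ≠ ⊤ :=
    ne_top_of_le_ne_top (by norm_cast; exact ENat.natCast_ne_top _) hle
  obtain ⟨N, hNball, hNfin, hNcover, hNcard⟩ := exists_set_encard_eq_coveringNumber htop
  lift N to Finset E using hNfin
  rw [← hNcard, Set.encard_coe_eq_coe_finsetCard] at hle
  exact ⟨N, by exact_mod_cast hle, hNball, hNcover⟩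

lemma one_sub_mul_opNorm_le_of_isCover {ε : NNReal} {N : Set E}
    (hN : IsCover ε (closedBall (0 : E) 1) N) (f : E →L[ℝ] F) {m : ℝ} (hm : 0 ≤ m)
    (hf : ∀ c ∈ N, ‖f c‖ ≤ m) : (1 - ε) * ‖f‖ ≤ m := by
  suffices ‖f‖ ≤ m + ε * ‖f‖ by linarith
  refine f.opNorm_le_of_unit_norm (by positivity) fun u hu => ?_
  obtain ⟨c, hc, huc⟩ := hN (mem_closedBall_zero_iff.2 hu.le)
  have hdist : ‖u - c‖ ≤ ε := by
    rw [← dist_eq_norm]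
    exact edist_le_coe.1 huc
  calc ‖f u‖ = ‖f c + f (u - c)‖ := by rw [← map_add, add_sub_cancel]
    _ ≤ ‖f c‖ + ‖f (u - c)‖ := norm_add_le _ _
    _ ≤ m + ε * ‖f‖ := by
        rw [mul_comm]
        exact add_le_add (hf c hc) (f.le_opNorm_of_le hdist)

lemma opNorm_le_four_mul_of_isCover_half {N : Set E} (hN : IsCover 2⁻¹ (closedBall (0 : E) 1) N)
    (f : E →L[ℝ] E →L[ℝ] F) {m : ℝ} (hm : 0 ≤ m) (hf : ∀ c ∈ N, ∀ d ∈ N, ‖f c d‖ ≤ m) :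
    ‖f‖ ≤ 4 * m := by
  have hrow : ∀ c ∈ N, ‖f c‖ ≤ 2 * m := fun c hc => by
    have h := one_sub_mul_opNorm_le_of_isCover hN (f c) hm (hf c hc)
    push_cast at h
    linarith
  have h := one_sub_mul_opNorm_le_of_isCover hN f (by positivity) hrow
  push_cast at h
  linarith

end Net

/-! ### Random maps with subexponential distortion -/

section Distortion

variable {Ω ι E H : Type*} [NormedAddCommGroup E] [InnerProductSpace ℝ E] [NormedAddCommGroup H]
  [InnerProductSpace ℝ H]

/-- The error `⟪L x, L y⟫ - ⟪x, y⟫` made by a linear map on inner products, as a bilinear form. -/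
noncomputable def distortion (L : E →L[ℝ] H) : E →L[ℝ] E →L[ℝ] ℝ :=
  (innerSL ℝ).bilinearComp L L - innerSL ℝ

/-- Every inner product of two vectors of the unit ball is distorted by the random map `L` by a
centered subexponential amount, of variance and scale of order `1 / τ`. The outcomes `ω : Ω` are
equally likely. -/
def HasSubexponentialDistortion [Fintype Ω] (L : Ω → E →L[ℝ] H) (τ : ℝ) : Prop :=
  ∀ x y : E, ‖x‖ ≤ 1 → ‖y‖ ≤ 1 → ∀ r : ℝ, |r| ≤ τ →
    𝔼 ω, Real.exp (r * distortion (L ω) x y) ≤ Real.exp (r ^ 2 / τ)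

lemma distortion_apply (L : E →L[ℝ] H) (x y : E) : distortion L x y = ⟪L x, L y⟫ - ⟪x, y⟫ := rfl

lemma distortion_self (L : E →L[ℝ] H) (x : E) : distortion L x x = ‖L x‖ ^ 2 - ‖x‖ ^ 2 := by
  rw [distortion_apply, real_inner_self_eq_norm_sq, real_inner_self_eq_norm_sq]

namespace HasSubexponentialDistortion

variable [Fintype Ω] {L : Ω → E →L[ℝ] H} {τ : ℝ}

lemma restrict (h : HasSubexponentialDistortion L τ) (V : Submodule ℝ E) :
    HasSubexponentialDistortion (fun ω => L ω ∘L V.subtypeL) τ :=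
  fun x y hx hy => h x y hx hy

lemma expect_distortion_sq_le_of_norm_le_one (h : HasSubexponentialDistortion L τ) (hτ : 1 ≤ τ)
    {x y : E} (hx : ‖x‖ ≤ 1) (hy : ‖y‖ ≤ 1) : 𝔼 ω, distortion (L ω) x y ^ 2 ≤ 12 / τ := by
  have hτ0 : 0 < τ := one_pos.trans_le hτ
  have hsqrt : √τ ≤ τ := Real.sqrt_le_self_iff.2 (.inr hτ)
  have hexp : √τ ^ 2 / τ = 1 := by rw [Real.sq_sqrt hτ0.le, div_self hτ0.ne']
  have hpos : 𝔼 ω, Real.exp (√τ * distortion (L ω) x y) ≤ Real.exp 1 := by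
    rw [← hexp]
    exact h x y hx hy _ (by rwa [abs_of_nonneg (Real.sqrt_nonneg τ)])
  have hneg : 𝔼 ω, Real.exp (-(√τ * distortion (L ω) x y)) ≤ Real.exp 1 := by
    rw [← hexp, ← neg_sq]
    simp only [← neg_mul]
    exact h x y hx hy _ (by rwa [abs_neg, abs_of_nonneg (Real.sqrt_nonneg τ)])
  rw [le_div_iff₀ hτ0]
  calc (𝔼 ω, distortion (L ω) x y ^ 2) * τ = 𝔼 ω, (√τ * distortion (L ω) x y) ^ 2 := by
        rw [expect_mul]
        simp only [mul_pow, Real.sq_sqrt hτ0.le, mul_comm τ]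
    _ ≤ 𝔼 ω, 2 * (Real.exp (√τ * distortion (L ω) x y) +
          Real.exp (-(√τ * distortion (L ω) x y))) :=
        expect_le_expect fun ω _ => sq_le_two_mul_exp_add_exp_neg _
    _ ≤ 12 := by
        rw [← mul_expect, expect_add_distrib]
        linarith [Real.exp_one_lt_d9]

lemma expect_distortion_sq_le (h : HasSubexponentialDistortion L τ) (hτ : 1 ≤ τ) (x y : E) :
    𝔼 ω, distortion (L ω) x y ^ 2 ≤ 12 / τ * (‖x‖ * ‖y‖) ^ 2 := by
  have hnormalize : ∀ z : E, ‖z‖ • ‖z‖⁻¹ • z = z := fun z => by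
    rcases eq_or_ne z 0 with rfl | hz
    · simp only [smul_zero]
    · exact smul_inv_smul₀ (norm_ne_zero_iff.2 hz) z
  have hnorm : ∀ z : E, ‖‖z‖⁻¹ • z‖ ≤ 1 := fun z => by
    rw [norm_smul, norm_inv, norm_norm]
    exact inv_mul_le_one
  have hscale : ∀ ω, distortion (L ω) x y ^ 2 =
      distortion (L ω) (‖x‖⁻¹ • x) (‖y‖⁻¹ • y) ^ 2 * (‖x‖ * ‖y‖) ^ 2 := fun ω => by
    conv_lhs => rw [← hnormalize x, ← hnormalize y]
    simp only [map_smul, _root_.smul_apply, smul_eq_mul]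
    ring
  simp only [hscale]
  rw [← expect_mul]
  exact mul_le_mul_of_nonneg_right
    (h.expect_distortion_sq_le_of_norm_le_one hτ (hnorm x) (hnorm y)) (sq_nonneg _)

variable [Nonempty Ω]

lemma prob_lt_distortion_le (h : HasSubexponentialDistortion L τ) (hτ : 0 < τ) {x y : E}
    (hx : ‖x‖ ≤ 1) (hy : ‖y‖ ≤ 1) {η : ℝ} (hη : 0 < η) (hη2 : η ≤ 2) :
    prob (PMF.uniformOfFintype Ω) {ω | η < distortion (L ω) x y} ≤
      Real.exp (-(τ * η ^ 2 / 4)) := by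
  have hr : 0 < τ * η / 2 := by positivity
  have hevent : {ω | η < distortion (L ω) x y} ⊆
      {ω | Real.exp (τ * η / 2 * η) < Real.exp (τ * η / 2 * distortion (L ω) x y)} :=
    fun ω hω => Real.exp_lt_exp.2 (mul_lt_mul_of_pos_left hω hr)
  refine (prob_mono _ hevent).trans (prob_lt_le_of_expect_le (fun ω => (Real.exp_pos _).le)
    (Real.exp_pos _).le (Real.exp_pos _).le ?_)
  refine (h x y hx hy (τ * η / 2) ?_).trans (le_of_eq ?_)
  · rw [abs_of_pos hr]
    nlinarith
  · rw [← Real.exp_add]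
    congr 1
    field_simp
    ring

lemma prob_lt_abs_distortion_le (h : HasSubexponentialDistortion L τ) (hτ : 0 < τ) {x y : E}
    (hx : ‖x‖ ≤ 1) (hy : ‖y‖ ≤ 1) {η : ℝ} (hη : 0 < η) (hη2 : η ≤ 2) :
    prob (PMF.uniformOfFintype Ω) {ω | η < |distortion (L ω) x y|} ≤
      2 * Real.exp (-(τ * η ^ 2 / 4)) := by
  have hevent : {ω | η < |distortion (L ω) x y|} ⊆
      {ω | η < distortion (L ω) x y} ∪ {ω | η < distortion (L ω) (-x) y} := fun ω hω => by
    simpa only [Set.mem_union, Set.mem_ofPred_eq, map_neg, _root_.neg_apply,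
      lt_abs] using hω
  calc _ ≤ _ := (prob_mono _ hevent).trans (prob_union_le _ _ _)
    _ ≤ _ := add_le_add (h.prob_lt_distortion_le hτ hx hy hη hη2)
        (h.prob_lt_distortion_le hτ (by rwa [norm_neg]) hy hη hη2)
    _ = _ := (two_mul _).symm

lemma prob_lt_norm_distortion_le [FiniteDimensional ℝ E] (h : HasSubexponentialDistortion L τ)
    (hτ : 0 < τ) {e : ℝ} (he : 0 < e) (he8 : e ≤ 8) :
    prob (PMF.uniformOfFintype Ω) {ω | e < ‖distortion (L ω)‖} ≤
      25 ^ Module.finrank ℝ E * (2 * Real.exp (-(τ * e ^ 2 / 64))) := by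
  obtain ⟨N, hcard, hball, hcover⟩ := exists_isCover_closedBall_card_le E
  let B : E × E → Set Ω := fun p => {ω | e / 4 < |distortion (L ω) p.1 p.2|}
  have hevent : {ω | e < ‖distortion (L ω)‖} ⊆ ⋃ p ∈ N ×ˢ N, B p := fun ω hω => by
    by_contra hωB
    simp only [B, Set.mem_iUnion, mem_product, Set.mem_ofPred_eq, not_exists, not_lt] at hωB
    have hnorm := opNorm_le_four_mul_of_isCover_half hcover (distortion (L ω)) (by positivity)
      fun c hc d hd => hωB (c, d) ⟨hc, hd⟩
    exact (hnorm.trans_eq (by ring)).not_gt hω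
  have hB : ∀ p ∈ N ×ˢ N, prob (PMF.uniformOfFintype Ω) (B p) ≤
      2 * Real.exp (-(τ * e ^ 2 / 64)) := fun p hp => by
    have hp1 := mem_closedBall_zero_iff.1 (hball (mem_product.1 hp).1)
    have hp2 := mem_closedBall_zero_iff.1 (hball (mem_product.1 hp).2)
    refine (h.prob_lt_abs_distortion_le hτ hp1 hp2 (by positivity) (by linarith)).trans_eq ?_
    ring_nf
  have hpairs : ((N ×ˢ N).card : ℝ) ≤ 25 ^ Module.finrank ℝ E := by
    have h25 : N.card * N.card ≤ 25 ^ Module.finrank ℝ E := by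
      refine (Nat.mul_le_mul hcard hcard).trans_eq ?_
      rw [← mul_pow]; norm_num
    rw [card_product]
    exact_mod_cast h25
  calc prob (PMF.uniformOfFintype Ω) {ω | e < ‖distortion (L ω)‖}
      ≤ ∑ p ∈ N ×ˢ N, prob (PMF.uniformOfFintype Ω) (B p) :=
        (prob_mono _ hevent).trans (prob_biUnion_le _ _ _)
    _ ≤ (N ×ˢ N).card * (2 * Real.exp (-(τ * e ^ 2 / 64))) := by
        rw [← nsmul_eq_mul]
        exact sum_le_card_nsmul _ _ _ hB
    _ ≤ 25 ^ Module.finrank ℝ E * (2 * Real.exp (-(τ * e ^ 2 / 64))) := by gcongr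

variable [Fintype ι]

lemma prob_lt_sum_norm_sq_le (h : HasSubexponentialDistortion L τ) (hτ : 1 ≤ τ) (m : ι → E) {e : ℝ}
    (he : 0 < e) :
    prob (PMF.uniformOfFintype Ω) {ω | (1 + e) * ∑ i, ‖m i‖ ^ 2 < ∑ i, ‖L ω (m i)‖ ^ 2} ≤
      12 / (τ * e ^ 2) := by
  have hevent : {ω | (1 + e) * ∑ i, ‖m i‖ ^ 2 < ∑ i, ‖L ω (m i)‖ ^ 2} ⊆
      {ω | (e * ∑ i, ‖m i‖ ^ 2) ^ 2 < (∑ i, distortion (L ω) (m i) (m i)) ^ 2} := fun ω hω => by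
    rw [Set.mem_ofPred_eq] at hω ⊢
    refine pow_lt_pow_left₀ ?_ (by positivity) two_ne_zero
    simp only [distortion_self, sum_sub_distrib]
    linarith
  have hmoment : 𝔼 ω, (∑ i, distortion (L ω) (m i) (m i)) ^ 2 ≤
      12 / τ * (∑ i, ‖m i‖ ^ 2) ^ 2 := by
    refine expect_sum_sq_le (by positivity) (fun i => sq_nonneg _) fun i => ?_
    rw [sq ‖m i‖]
    exact h.expect_distortion_sq_le hτ (m i) (m i)
  refine (prob_mono _ hevent).trans (prob_lt_le_of_expect_le (fun ω => sq_nonneg _) (sq_nonneg _)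
    (by positivity) (hmoment.trans_eq ?_))
  field_simp

lemma prob_lt_sum_sum_distortion_sq_le {κ : Type*} [Fintype κ]
    (h : HasSubexponentialDistortion L τ) (hτ : 1 ≤ τ) (v : κ → E) (hv : ∀ j, ‖v j‖ ≤ 1)
    (b : ι → E) {e : ℝ} (he : 0 < e) :
    prob (PMF.uniformOfFintype Ω)
        {ω | e ^ 2 * ∑ i, ‖b i‖ ^ 2 < ∑ i, ∑ j, distortion (L ω) (v j) (b i) ^ 2} ≤
      12 * Fintype.card κ / (τ * e ^ 2) := by
  refine prob_lt_le_of_expect_le (fun ω => by positivity) (by positivity) (by positivity) ?_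
  calc 𝔼 ω, ∑ i, ∑ j, distortion (L ω) (v j) (b i) ^ 2
      = ∑ i, ∑ j, 𝔼 ω, distortion (L ω) (v j) (b i) ^ 2 := by simp only [expect_sum_comm]
    _ ≤ ∑ i, ∑ _j : κ, 12 / τ * ‖b i‖ ^ 2 := by
        gcongr with i _ j _
        refine (h.expect_distortion_sq_le hτ (v j) (b i)).trans ?_
        gcongr
        exact mul_le_of_le_one_left (norm_nonneg _) (hv j)
    _ = 12 * Fintype.card κ / (τ * e ^ 2) * (e ^ 2 * ∑ i, ‖b i‖ ^ 2) := by
        simp only [sum_const, card_univ, nsmul_eq_mul, ← mul_sum]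
        field_simp

end HasSubexponentialDistortion

end Distortion

/-! ### Star projections acting on families of vectors -/

section StarProjection

variable {ι E H : Type*} [Fintype ι] [DecidableEq ι] [NormedAddCommGroup E] [InnerProductSpace ℝ E]
  [NormedAddCommGroup H] [InnerProductSpace ℝ H]

lemma map_matrix_smul_apply (T : E →ₗ[ℝ] H) (M : Matrix ι ι ℝ) (f : ι → E) (i : ι) :
    T ((M • f) i) = (M • fun i => T (f i)) i := by
  simp only [Matrix.Module.smul_apply, map_sum, map_smul]

lemma sum_inner_matrix_smul_left (M : Matrix ι ι ℝ) (f g : ι → E) :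
    ∑ i, ⟪(M • f) i, g i⟫ = ∑ i, ⟪f i, (Mᵀ • g) i⟫ := by
  simp only [Matrix.Module.smul_apply, sum_inner, inner_sum, real_inner_smul_left,
    real_inner_smul_right, transpose_apply]
  exact sum_comm

lemma sum_inner_smul_right_of_smul_eq {M : Matrix ι ι ℝ} (hM : IsStarProjection M) {f : ι → E}
    (hf : M • f = f) (g : ι → E) : ∑ i, ⟪f i, (M • g) i⟫ = ∑ i, ⟪f i, g i⟫ := by
  have hsymm : Mᵀ = M := by
    rw [← conjTranspose_eq_transpose_of_trivial]
    exact hM.isSelfAdjoint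
  nth_rw 1 [← hsymm]
  rw [← sum_inner_matrix_smul_left, hf]

lemma sum_norm_sq_smul_le {M : Matrix ι ι ℝ} (hM : IsStarProjection M) (f : ι → E) :
    ∑ i, ‖(M • f) i‖ ^ 2 ≤ ∑ i, ‖f i‖ ^ 2 := by
  have hfixed : M • M • f = M • f := by rw [smul_smul, hM.isIdempotentElem.eq]
  have hinner := sum_inner_smul_right_of_smul_eq hM hfixed f
  have hsub : 0 ≤ ∑ i, ‖f i - (M • f) i‖ ^ 2 := sum_nonneg fun i _ => sq_nonneg _
  simp only [norm_sub_sq_real, sum_add_distrib, sum_sub_distrib, ← mul_sum,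
    real_inner_self_eq_norm_sq, real_inner_comm ((M • f) _)] at hinner hsub
  linarith

end StarProjection

/-! ### Projection costs of a sketch -/

section ProjectionCost

variable {ι κ E H : Type*} [Fintype ι] [Fintype κ] [NormedAddCommGroup E] [InnerProductSpace ℝ E]
  [NormedAddCommGroup H] [InnerProductSpace ℝ H]

lemma one_sub_mul_norm_sq_le {L : E →L[ℝ] H} {e : ℝ} (hL : ‖distortion L‖ ≤ e) (x : E) :
    (1 - e) * ‖x‖ ^ 2 ≤ ‖L x‖ ^ 2 := by
  have habs : |distortion L x x| ≤ e * ‖x‖ * ‖x‖ := (distortion L).le_of_opNorm₂_le_of_le hL le_rfl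
    le_rfl
  rw [distortion_self] at habs
  linarith [neg_le_of_abs_le habs]

lemma sq_sum_inner_map_le (T : E →ₗ[ℝ] H) (v : OrthonormalBasis κ ℝ E) (x : ι → E) (y : ι → H) :
    (∑ i, ⟪T (x i), y i⟫) ^ 2 ≤ (∑ i, ‖x i‖ ^ 2) * ∑ i, ∑ j, ⟪T (v j), y i⟫ ^ 2 := by
  have hexpand : ∀ i, ⟪T (x i), y i⟫ = ∑ j, ⟪v j, x i⟫ * ⟪T (v j), y i⟫ := fun i => by
    conv_lhs => rw [← v.sum_repr' (x i)]
    simp only [map_sum, map_smul, sum_inner, real_inner_smul_left]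
  simp only [hexpand, ← v.sum_sq_inner_right]
  simp only [← Fintype.sum_prod_type']
  exact sum_mul_sq_le_sq_mul_sq _ _ _

lemma sum_norm_sq_eq_add_orthogonalProjectionOnto (V : Submodule ℝ E) [V.HasOrthogonalProjection]
    (f : ι → E) : ∑ i, ‖f i‖ ^ 2 =
      ∑ i, ‖V.orthogonalProjectionOnto (f i)‖ ^ 2 + ∑ i, ‖f i - V.starProjection (f i)‖ ^ 2 := by
  rw [← sum_add_distrib]
  refine sum_congr rfl fun i _ => ?_
  rw [V.norm_sq_eq_add_norm_sq_projection (f i), ← V.starProjection_orthogonal_val]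
  rfl

variable [DecidableEq ι]

-- `M` fixes the part of `M • a` inside `V` and is self-adjoint, so it drops out of the inner
-- product of that part with the part `M • b` outside of `V`.
lemma sum_norm_sq_map_orthogonalProjection_smul_le (L : E →L[ℝ] H) {V : Submodule ℝ E}
    [V.HasOrthogonalProjection] (v : OrthonormalBasis κ ℝ V) (a : ι → E) {M : Matrix ι ι ℝ}
    (hM : IsStarProjection M) {s : ℝ} (hs : 0 ≤ s)
    (hcross : ∑ i, ∑ j, ⟪L (v j), L (a i - V.starProjection (a i))⟫ ^ 2 ≤ s ^ 2) :
    ∑ i, ‖L (V.starProjection ((M • a) i))‖ ^ 2 ≤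
      √(∑ i, ‖L (V.starProjection ((M • a) i))‖ ^ 2) * √(∑ i, ‖L ((M • a) i)‖ ^ 2) +
        s * √(∑ i, ‖V.orthogonalProjectionOnto ((M • a) i)‖ ^ 2) := by
  set P := V.starProjection
  set b : ι → E := fun i => a i - P (a i)
  have hfixed : (M • fun i => L (P ((M • a) i))) = fun i => L (P ((M • a) i)) := by
    have hmap : ∀ i, L (P ((M • a) i)) = (M • fun i => L (P (a i))) i :=
      map_matrix_smul_apply (L ∘L P).toLinearMap M a
    simp only [hmap]
    exact (smul_smul M M _).trans (by rw [hM.isIdempotentElem.eq])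
  have hresidual : ∀ i, L ((M • a) i) = L (P ((M • a) i)) + (M • fun i => L (b i)) i := fun i => by
    have hmap := map_matrix_smul_apply (L ∘L (ContinuousLinearMap.id ℝ E - P)).toLinearMap M a i
    rw [← sub_eq_iff_eq_add', ← map_sub]
    exact hmap
  have hdecomp : ∑ i, ‖L (P ((M • a) i))‖ ^ 2 =
      ∑ i, ⟪L (P ((M • a) i)), L ((M • a) i)⟫ - ∑ i, ⟪L (P ((M • a) i)), L (b i)⟫ := by
    rw [← sum_inner_smul_right_of_smul_eq hM hfixed fun i => L (b i)]
    simp only [hresidual, inner_add_right, sum_add_distrib, real_inner_self_eq_norm_sq]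
    exact (add_sub_cancel_right _ _).symm
  have hinside : ∑ i, ⟪L (P ((M • a) i)), L ((M • a) i)⟫ ≤
      √(∑ i, ‖L (P ((M • a) i))‖ ^ 2) * √(∑ i, ‖L ((M • a) i)‖ ^ 2) :=
    (sum_le_sum fun i _ => real_inner_le_norm _ _).trans (Real.sum_mul_le_sqrt_mul_sqrt _ _ _)
  have hacross : -(s * √(∑ i, ‖V.orthogonalProjectionOnto ((M • a) i)‖ ^ 2)) ≤
      ∑ i, ⟪L (P ((M • a) i)), L (b i)⟫ := by
    refine neg_le_of_abs_le (abs_le_of_sq_le_sq ?_ (by positivity))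
    rw [mul_pow, Real.sq_sqrt (by positivity), mul_comm]
    exact (sq_sum_inner_map_le (L ∘L V.subtypeL).toLinearMap v
      (fun i => V.orthogonalProjectionOnto ((M • a) i)) fun i => L (b i)).trans
      (by gcongr; exact hcross)
  linarith

lemma sq_le_of_sq_le_mul_add {N r μ f γ e : ℝ} (hN : 0 ≤ N) (hr : 0 ≤ r) (hf : 0 ≤ f)
    (hγ : 1 ≤ γ) (he : 0 ≤ e) (he1 : e ≤ 1 / 10) (hNr : (1 - e) * N ^ 2 ≤ r ^ 2)
    (hrμ : r ^ 2 ≤ r * μ + e * f * N) (hμ : μ ^ 2 ≤ γ * ((1 + e) * f ^ 2)) :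
    N ^ 2 ≤ (1 + 10 * e) * γ * f ^ 2 := by
  set g := √γ * f with hg
  have hg2 : g ^ 2 = γ * f ^ 2 := by rw [hg, mul_pow, Real.sq_sqrt (by linarith)]
  have hfg : f ≤ g := le_mul_of_one_le_left hf (Real.one_le_sqrt.2 hγ)
  have hg0 : 0 ≤ g := hf.trans hfg
  have hμg : μ ≤ (1 + e) * g := by
    refine le_of_sq_le_sq ?_ (mul_nonneg (by linarith) hg0)
    rw [mul_pow]
    nlinarith [sq_nonneg g]
  have hNr' : N ≤ 1.1 * r := by
    refine le_of_sq_le_sq ?_ (by positivity)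
    nlinarith [sq_nonneg N]
  have hrg : r ≤ (1 + 2.1 * e) * g := by
    rcases hr.eq_or_lt with h | h
    · rw [← h]
      positivity
    · refine le_of_mul_le_mul_left ?_ h
      calc r * r ≤ r * μ + e * f * N := by linarith
        _ ≤ r * ((1 + e) * g) + e * g * (1.1 * r) := by gcongr
        _ = r * ((1 + 2.1 * e) * g) := by ring
  refine le_of_mul_le_mul_left ?_ (by linarith : 0 < 1 - e)
  calc (1 - e) * N ^ 2 ≤ ((1 + 2.1 * e) * g) ^ 2 := hNr.trans (pow_le_pow_left₀ hr hrg 2)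
    _ = (1 + 2.1 * e) ^ 2 * g ^ 2 := mul_pow _ _ _
    _ ≤ (1 - e) * (1 + 10 * e) * g ^ 2 := by
        gcongr
        nlinarith
    _ = (1 - e) * ((1 + 10 * e) * γ * f ^ 2) := by
        rw [hg2]
        ring

lemma sum_norm_sq_smul_le_of_sketch (L : E →L[ℝ] H) {V : Submodule ℝ E}
    [V.HasOrthogonalProjection] (v : OrthonormalBasis κ ℝ V) (a : ι → E) {M : Matrix ι ι ℝ}
    (hM : IsStarProjection M) {F γ e : ℝ} (hγ : 1 ≤ γ) (he : 0 ≤ e) (he1 : e ≤ 1 / 10)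
    (hV : ‖distortion (L ∘L V.subtypeL)‖ ≤ e)
    (hout : ∑ i, ‖a i - V.starProjection (a i)‖ ^ 2 ≤ F)
    (hcross : ∑ i, ∑ j, ⟪L (v j), L (a i - V.starProjection (a i))⟫ ^ 2 ≤ e ^ 2 * F)
    (hcost : ∑ i, ‖L ((M • a) i)‖ ^ 2 ≤ γ * ((1 + e) * F)) :
    ∑ i, ‖(M • a) i‖ ^ 2 ≤ (1 + (1 + 10 * e) * γ) * F := by
  have hF : 0 ≤ F := le_trans (by positivity) hout
  have hsqrtF : e ^ 2 * F = (e * √F) ^ 2 := by rw [mul_pow, Real.sq_sqrt hF]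
  have houtside : ∑ i, ‖(M • a) i - V.starProjection ((M • a) i)‖ ^ 2 ≤ F := by
    have hmap : ∀ i, (M • a) i - V.starProjection ((M • a) i) =
        (M • fun i => a i - V.starProjection (a i)) i :=
      map_matrix_smul_apply (ContinuousLinearMap.id ℝ E - V.starProjection).toLinearMap M a
    simp only [hmap]
    exact (sum_norm_sq_smul_le hM _).trans hout
  have hiso : (1 - e) * √(∑ i, ‖V.orthogonalProjectionOnto ((M • a) i)‖ ^ 2) ^ 2 ≤
      √(∑ i, ‖L (V.starProjection ((M • a) i))‖ ^ 2) ^ 2 := by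
    rw [Real.sq_sqrt (by positivity), Real.sq_sqrt (by positivity), mul_sum]
    exact sum_le_sum fun i _ => one_sub_mul_norm_sq_le hV _
  have hself := sum_norm_sq_map_orthogonalProjection_smul_le L v a hM (s := e * √F)
    (by positivity) (hcross.trans_eq hsqrtF)
  have hinside := sq_le_of_sq_le_mul_add (μ := √(∑ i, ‖L ((M • a) i)‖ ^ 2)) (Real.sqrt_nonneg _)
    (Real.sqrt_nonneg _) (Real.sqrt_nonneg F) hγ he he1 hiso
    (by rwa [Real.sq_sqrt (by positivity)])
    (by rwa [Real.sq_sqrt (by positivity), Real.sq_sqrt hF])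
  rw [Real.sq_sqrt (by positivity), Real.sq_sqrt hF] at hinside
  rw [sum_norm_sq_eq_add_orthogonalProjectionOnto V]
  linarith

/-- The sketch `L` preserves the cost `∑ i, ‖(M • a) i‖ ^ 2` of orthogonal projections `M` of the
points `a`, relative to the centers `c`: if, after sketching, `M` costs at most `γ` times as much as
the centers, then before sketching it costs at most `1 + (1 + ε) * γ` times as much. -/
def PreservesProjectionCost (L : E →L[ℝ] H) (a c : ι → E) (ε : ℝ) : Prop :=
  ∀ γ : ℝ, 1 ≤ γ → ∀ M : Matrix ι ι ℝ, IsStarProjection M →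
    ∑ i, ‖L ((M • a) i)‖ ^ 2 ≤ γ * ∑ i, ‖L (a i - c i)‖ ^ 2 →
      ∑ i, ‖(M • a) i‖ ^ 2 ≤ (1 + (1 + ε) * γ) * ∑ i, ‖a i - c i‖ ^ 2

lemma preservesProjectionCost_of_distortion (L : E →L[ℝ] H) {V : Submodule ℝ E}
    [V.HasOrthogonalProjection] (v : OrthonormalBasis κ ℝ V) (a : ι → E) {c : ι → E}
    (hc : ∀ i, c i ∈ V) {e : ℝ} (he : 0 ≤ e) (he1 : e ≤ 1 / 10)
    (hcost : ∑ i, ‖L (a i - c i)‖ ^ 2 ≤ (1 + e) * ∑ i, ‖a i - c i‖ ^ 2)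
    (hV : ‖distortion (L ∘L V.subtypeL)‖ ≤ e)
    (hcross : ∑ i, ∑ j, distortion L (v j) (a i - V.starProjection (a i)) ^ 2 ≤
      e ^ 2 * ∑ i, ‖a i - V.starProjection (a i)‖ ^ 2) :
    PreservesProjectionCost L a c (10 * e) := by
  intro γ hγ M hM hMcost
  have hout : ∑ i, ‖a i - V.starProjection (a i)‖ ^ 2 ≤ ∑ i, ‖a i - c i‖ ^ 2 := by
    gcongr with i
    rw [V.starProjection_minimal (a i)]
    exact ciInf_le ⟨0, Set.forall_mem_range.2 fun x => norm_nonneg _⟩ (⟨c i, hc i⟩ : V)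
  refine sum_norm_sq_smul_le_of_sketch L v a hM hγ he he1 hV hout ?_
    (hMcost.trans (by gcongr))
  have horth : ∀ i j, ⟪(v j : E), a i - V.starProjection (a i)⟫ = 0 := fun i j => by
    rw [real_inner_comm]
    exact V.starProjection_inner_eq_zero (a i) _ (v j).2
  simp only [distortion_apply, horth, sub_zero] at hcross
  exact hcross.trans (by gcongr)

lemma pow_mul_two_mul_exp_neg_le {k : ℕ} (hk : 0 < k) {x : ℝ} (hx : 10 * k ≤ x) :
    25 ^ k * (2 * Real.exp (-x)) ≤ 0.01 := by
  have hexp : Real.exp (-10) ≤ (0.005 : ℝ) / 25 := by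
    have hpow : Real.exp 10 = Real.exp 1 ^ 10 := by
      rw [← Real.exp_nat_mul]
      norm_num
    rw [Real.exp_neg, inv_le_comm₀ (Real.exp_pos _) (by norm_num), hpow]
    exact le_trans (by norm_num) (pow_le_pow_left₀ (by norm_num) Real.exp_one_gt_d9.le 10)
  calc (25 : ℝ) ^ k * (2 * Real.exp (-x)) ≤ 25 ^ k * (2 * Real.exp (k * -10)) := by
        gcongr
        linarith
    _ = 2 * (25 * Real.exp (-10)) ^ k := by
        rw [Real.exp_nat_mul, mul_pow]
        ring
    _ ≤ 2 * (25 * (0.005 / 25)) ^ k := by gcongr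
    _ ≤ 2 * (25 * (0.005 / 25)) ^ 1 := by
        gcongr ?_ * ?_
        exact pow_le_pow_of_le_one (by norm_num) (by norm_num) hk
    _ = 0.01 := by norm_num

lemma HasSubexponentialDistortion.le_prob_preservesProjectionCost {Ω : Type*} [Fintype Ω]
    [Nonempty Ω] {L : Ω → E →L[ℝ] H} {τ : ℝ} (h : HasSubexponentialDistortion L τ)
    {V : Submodule ℝ E} [FiniteDimensional ℝ V] {k : ℕ} (hk : 0 < k)
    (hVk : Module.finrank ℝ V ≤ k) (a : ι → E) {c : ι → E} (hc : ∀ i, c i ∈ V) {ε : ℝ}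
    (hε : 0 < ε) (hε1 : ε ≤ 1) (hτ : 120000 * k ≤ τ * ε ^ 2) :
    0.97 ≤ prob (PMF.uniformOfFintype Ω) {ω | PreservesProjectionCost (L ω) a c ε} := by
  obtain ⟨e, rfl⟩ : ∃ e, ε = 10 * e := ⟨ε / 10, by ring⟩
  have he : 0 < e := by linarith
  have hk1 : (1 : ℝ) ≤ k := by exact_mod_cast hk
  have hτ1 : 1 ≤ τ := by nlinarith
  let v := stdOrthonormalBasis ℝ V
  let b : ι → E := fun i => a i - V.starProjection (a i)
  let B₁ : Set Ω := {ω | (1 + e) * ∑ i, ‖a i - c i‖ ^ 2 < ∑ i, ‖L ω (a i - c i)‖ ^ 2}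
  let B₂ : Set Ω := {ω | e < ‖distortion (L ω ∘L V.subtypeL)‖}
  let B₃ : Set Ω :=
    {ω | e ^ 2 * ∑ i, ‖b i‖ ^ 2 < ∑ i, ∑ j, distortion (L ω) (v j) (b i) ^ 2}
  have hB₁ : prob (PMF.uniformOfFintype Ω) B₁ ≤ 0.01 := by
    refine (h.prob_lt_sum_norm_sq_le hτ1 _ he).trans ?_
    rw [div_le_iff₀ (by positivity)]
    linarith
  have hB₂ : prob (PMF.uniformOfFintype Ω) B₂ ≤ 0.01 := by
    refine ((h.restrict V).prob_lt_norm_distortion_le (by linarith) he (by linarith)).trans ?_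
    refine le_trans ?_ (pow_mul_two_mul_exp_neg_le hk (x := τ * e ^ 2 / 64) (by linarith))
    gcongr
    norm_num
  have hB₃ : prob (PMF.uniformOfFintype Ω) B₃ ≤ 0.01 := by
    refine (h.prob_lt_sum_sum_distortion_sq_le hτ1 _ (fun j => (v.norm_eq_one j).le) b he).trans ?_
    have hcard : (Module.finrank ℝ V : ℝ) ≤ k := by exact_mod_cast hVk
    rw [div_le_iff₀ (by positivity), Fintype.card_fin]
    linarith
  have hgood : (B₁ ∪ B₂ ∪ B₃)ᶜ ⊆ {ω | PreservesProjectionCost (L ω) a c (10 * e)} := by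
    intro ω hω
    simp only [B₁, B₂, B₃, Set.compl_union, Set.mem_inter_iff, Set.mem_compl_iff,
      Set.mem_ofPred_eq, not_lt] at hω
    obtain ⟨⟨hcost, hV⟩, hcross⟩ := hω
    exact preservesProjectionCost_of_distortion (L ω) v a hc he.le (by linarith) hcost hV hcross
  refine le_trans ?_ (prob_mono _ hgood)
  rw [prob_compl]
  linarith [prob_union_le (PMF.uniformOfFintype Ω) (B₁ ∪ B₂) B₃,
    prob_union_le (PMF.uniformOfFintype Ω) B₁ B₂]

end ProjectionCost

/-! ### The sign sketch -/

section SignSketch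

/-- The linear map `x ↦ x R` on row vectors. -/
noncomputable def sketch {ι κ : Type*} [Fintype ι] [DecidableEq ι] [Fintype κ] (R : Matrix ι κ ℝ) :
    EuclideanSpace ℝ ι →L[ℝ] EuclideanSpace ℝ κ :=
  LinearMap.toContinuousLinearMap (Matrix.toEuclideanLin Rᵀ)

lemma sketch_apply {ι κ : Type*} [Fintype ι] [DecidableEq ι] [Fintype κ] (R : Matrix ι κ ℝ)
    (x : EuclideanSpace ℝ ι) (l : κ) : sketch R x l = ∑ i, x i * R i l := by
  simp only [sketch, LinearMap.coe_toContinuousLinearMap', Matrix.toLpLin_apply, Matrix.mulVec,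
    dotProduct, transpose_apply, mul_comm]

variable {d t : ℕ}

/-- The matrix with entries `± 1 / √t` given by a sign pattern; `signMatrix d t` is its law for a
uniformly random pattern. -/
noncomputable def scaledSignMatrix (s : Fin d → Fin t → Bool) : Matrix (Fin d) (Fin t) ℝ :=
  Matrix.of fun i j => if s i j then 1 / √(t : ℝ) else -(1 / √(t : ℝ))

lemma scaledSignMatrix_apply (s : Fin d → Fin t → Bool) (i : Fin d) (l : Fin t) :
    scaledSignMatrix s i l = sign (s i l) / √(t : ℝ) := by
  rw [scaledSignMatrix, Matrix.of_apply, sign]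
  split_ifs
  · rfl
  · rw [neg_div]

lemma prob_signMatrix (S : Set (Matrix (Fin d) (Fin t) ℝ)) :
    prob (signMatrix d t) S = prob (PMF.uniformOfFintype (Fin d → Fin t → Bool))
      {s | scaledSignMatrix s ∈ S} :=
  prob_map _ scaledSignMatrix S

lemma sketch_scaledSignMatrix_apply (s : Fin d → Fin t → Bool) (x : EuclideanSpace ℝ (Fin d))
    (l : Fin t) :
    sketch (scaledSignMatrix s) x l = signedSum x (fun i => s i l) / √(t : ℝ) := by
  simp only [sketch_apply, scaledSignMatrix_apply, signedSum, sum_div, mul_div_assoc]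

lemma distortion_sketch_scaledSignMatrix (ht : 0 < t) (s : Fin d → Fin t → Bool)
    (x y : EuclideanSpace ℝ (Fin d)) :
    distortion (sketch (scaledSignMatrix s)) x y =
      (∑ l, centeredProd x y fun i => s i l) / t := by
  have ht0 : (t : ℝ) ≠ 0 := by positivity
  have hinner : ⟪sketch (scaledSignMatrix s) x, sketch (scaledSignMatrix s) y⟫ =
      (∑ l, signedSum x (fun i => s i l) * signedSum y (fun i => s i l)) / t := by
    simp only [PiLp.inner_apply, sketch_scaledSignMatrix_apply, sum_div, RCLike.inner_apply,
      conj_trivial, div_mul_div_comm, Real.mul_self_sqrt (Nat.cast_nonneg t), mul_comm]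
  simp only [distortion_apply, hinner, centeredProd, sum_sub_distrib, sum_const, card_univ,
    Fintype.card_fin, nsmul_eq_mul]
  rw [sub_div, mul_div_cancel_left₀ _ ht0]

lemma hasSubexponentialDistortion_sketch_scaledSignMatrix (ht : 0 < t) :
    HasSubexponentialDistortion
      (fun s : Fin d → Fin t → Bool => sketch (scaledSignMatrix s)) (t / 256) := by
  intro x y hx hy r hr
  have ht0 : (0 : ℝ) < t := by exact_mod_cast ht
  have hr8 : |r / t| ≤ 1 / 8 := by
    rw [abs_div, abs_of_pos ht0, div_le_iff₀ ht0]
    linarith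
  have hexp : ∀ s : Fin d → Fin t → Bool,
      Real.exp (r * distortion (sketch (scaledSignMatrix s)) x y) =
        ∏ l, Real.exp (r / t * centeredProd x y fun i => s i l) := fun s => by
    rw [distortion_sketch_scaledSignMatrix ht, ← Real.exp_sum, ← mul_sum]
    ring_nf
  calc 𝔼 s : Fin d → Fin t → Bool, Real.exp (r * distortion (sketch (scaledSignMatrix s)) x y)
      = 𝔼 s : Fin t → Fin d → Bool, ∏ l, Real.exp (r / t * centeredProd x y (s l)) :=
        Fintype.expect_equiv (Equiv.piComm fun _ _ => Bool) _ _ hexp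
    _ = (𝔼 s : Fin d → Bool, Real.exp (r / t * centeredProd x y s)) ^ t := by
        rw [expect_prod_pi fun (_ : Fin t) s => Real.exp (r / t * centeredProd x y s), prod_const,
          card_univ, Fintype.card_fin]
    _ ≤ Real.exp (256 * (r / t) ^ 2) ^ t :=
        pow_le_pow_left₀ (expect_nonneg fun s _ => (Real.exp_pos _).le)
          (expect_exp_mul_centeredProd_le hx hy hr8) t
    _ = Real.exp (r ^ 2 / (t / 256)) := by
        rw [← Real.exp_nat_mul]
        congr 1
        field_simp

end SignSketch

/-! ### Clusterings of the rows of a matrix -/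

section Clustering

variable {n d m t k : ℕ}

lemma IsIndicator.mul_self_eq {X : Matrix (Fin n) (Fin k) ℝ} (hX : IsIndicator X) (i : Fin n)
    (j : Fin k) :
    X i j * X i j = (if X i j ≠ 0 then 1 else 0) / ((cluster X j).ncard : ℝ) := by
  split_ifs with hij
  · rw [hX.entry_eq i j hij, div_mul_div_comm, one_mul, Real.mul_self_sqrt (Nat.cast_nonneg _)]
  · rw [not_not.1 hij, mul_zero, zero_div]

lemma IsIndicator.transpose_mul_self {X : Matrix (Fin n) (Fin k) ℝ} (hX : IsIndicator X) :
    Xᵀ * X = 1 := by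
  ext j l
  simp only [Matrix.mul_apply, Matrix.one_apply, transpose_apply]
  split_ifs with hjl
  · subst hjl
    have hcard : #{i | X i j ≠ 0} = (cluster X j).ncard := by
      rw [← Set.ncard_coe_finset, coe_filter_univ]
      rfl
    have hpos : 0 < (cluster X j).ncard :=
      (Set.ncard_pos (Set.toFinite _)).2 (hX.cluster_nonempty j)
    simp only [hX.mul_self_eq]
    rw [← sum_div, sum_boole, hcard, div_self (by positivity)]
  · refine sum_eq_zero fun i _ => ?_
    by_contra hne
    exact hjl ((hX.existsUnique_ne_zero i).unique (left_ne_zero_of_mul hne)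
      (right_ne_zero_of_mul hne))

lemma IsIndicator.isStarProjection_mul_transpose {X : Matrix (Fin n) (Fin k) ℝ}
    (hX : IsIndicator X) : IsStarProjection (X * Xᵀ) where
  isIdempotentElem := by
    rw [IsIdempotentElem, Matrix.mul_assoc, ← Matrix.mul_assoc Xᵀ, hX.transpose_mul_self,
      Matrix.one_mul]
  isSelfAdjoint := by
    rw [← conjTranspose_eq_transpose_of_trivial]
    exact isHermitian_mul_conjTranspose_self X

/-- The `i`-th row of a matrix, as a vector in Euclidean space. -/
def row (A : Matrix (Fin n) (Fin m) ℝ) (i : Fin n) : EuclideanSpace ℝ (Fin m) := WithLp.toLp 2 (A i)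

lemma row_mul (A : Matrix (Fin n) (Fin d) ℝ) (R : Matrix (Fin d) (Fin t) ℝ) (i : Fin n) :
    row (A * R) i = sketch R (row A i) := by
  ext l
  rw [sketch_apply]
  rfl

lemma row_matrix_mul (M : Matrix (Fin n) (Fin n) ℝ) (A : Matrix (Fin n) (Fin m) ℝ) :
    row (M * A) = M • row A := by
  ext i j
  simp [row, Matrix.mul_apply, Matrix.Module.smul_apply]

attribute [local instance] Matrix.frobeniusNormedAddCommGroup in
lemma cost_eq_sum (A : Matrix (Fin n) (Fin m) ℝ) (X : Indicator n k) :
    cost A X = ∑ i, ‖((1 - X.1 * X.1ᵀ) • row A) i‖ ^ 2 := by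
  rw [← row_matrix_mul, Matrix.sub_mul, Matrix.one_mul, cost, Matrix.frobenius_norm_def,
    ← Real.sqrt_eq_rpow, Real.sq_sqrt (by positivity)]
  simp only [EuclideanSpace.norm_sq_eq, Real.rpow_two]
  rfl

lemma cost_mul_eq_sum (A : Matrix (Fin n) (Fin d) ℝ) (R : Matrix (Fin d) (Fin t) ℝ)
    (X : Indicator n k) :
    cost (A * R) X = ∑ i, ‖sketch R (((1 - X.1 * X.1ᵀ) • row A) i)‖ ^ 2 := by
  have hmap := map_matrix_smul_apply (sketch R).toLinearMap (1 - X.1 * X.1ᵀ) (row A)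
  simp only [ContinuousLinearMap.coe_coe] at hmap
  simp only [cost_eq_sum, hmap, ← row_mul]

lemma exists_submodule_row_mem (A : Matrix (Fin n) (Fin m) ℝ) (Y : Matrix (Fin n) (Fin k) ℝ)
    (Z : Matrix (Fin k) (Fin n) ℝ) :
    ∃ V : Submodule ℝ (EuclideanSpace ℝ (Fin m)), Module.finrank ℝ V ≤ k ∧
      ∀ i, ((Y * Z) • row A) i ∈ V := by
  refine ⟨Submodule.span ℝ (Set.range (row (Z * A))), ?_, fun i => ?_⟩
  · exact (finrank_range_le_card _).trans_eq (Fintype.card_fin k)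
  · have hrow : ((Y * Z) • row A) i = ∑ j, Y i j • row (Z * A) j := by
      rw [← row_matrix_mul, Matrix.mul_assoc]
      ext l
      simp [row, Matrix.mul_apply]
    rw [hrow]
    exact sum_mem fun j _ => Submodule.smul_mem _ _ (Submodule.subset_span ⟨j, rfl⟩)

/-- For every `γ ≥ 1`, a clustering of the rows of `B` that costs at most `γ` times as much as the
reference clustering `Y` costs, for the rows of `A`, at most `1 + (1 + ε) * γ` times as much as
`Y`. -/
def PreservesApproximation (A : Matrix (Fin n) (Fin d) ℝ) (B : Matrix (Fin n) (Fin m) ℝ)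
    (Y : Indicator n k) (ε : ℝ) : Prop :=
  ∀ γ : ℝ, 1 ≤ γ → ∀ X : Indicator n k, cost B X ≤ γ * cost B Y →
    cost A X ≤ (1 + (1 + ε) * γ) * cost A Y

lemma PreservesApproximation.preservesClustering {A : Matrix (Fin n) (Fin d) ℝ}
    {B : Matrix (Fin n) (Fin m) ℝ} {Y : Indicator n k} {ε : ℝ} (hε : 0 ≤ ε)
    (h : PreservesApproximation A B Y ε) (hY : IsOptimal A Y) :
    PreservesClustering k A B (2 + ε) := by
  intro X Xopt hX _
  calc cost A X ≤ (1 + (1 + ε) * 1) * cost A Y := h 1 le_rfl X ((hX Y).trans_eq (one_mul _).symm)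
    _ = (2 + ε) * cost A Y := by ring
    _ ≤ (2 + ε) * cost A Xopt := by
        gcongr
        exact hY Xopt

lemma preservesApproximation_of_preservesProjectionCost {A : Matrix (Fin n) (Fin d) ℝ}
    {R : Matrix (Fin d) (Fin t) ℝ} {Y : Indicator n k} {ε : ℝ}
    (h : PreservesProjectionCost (sketch R) (row A) ((Y.1 * Y.1ᵀ) • row A) ε) :
    PreservesApproximation A (A * R) Y ε := by
  have hresidual : ∀ i, row A i - ((Y.1 * Y.1ᵀ) • row A) i = ((1 - Y.1 * Y.1ᵀ) • row A) i :=
    fun i => by rw [sub_smul, one_smul, Pi.sub_apply]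
  simp only [PreservesProjectionCost, hresidual] at h
  intro γ hγ X hX
  rw [cost_mul_eq_sum, cost_mul_eq_sum] at hX
  rw [cost_eq_sum, cost_eq_sum]
  exact h γ hγ _ X.2.isStarProjection_mul_transpose.one_sub hX

lemma le_prob_preservesApproximation (A : Matrix (Fin n) (Fin d) ℝ) (hk : 0 < k) {ε : ℝ}
    (hε : 0 < ε) (hε1 : ε ≤ 1) (ht : 256 * 120000 * (k : ℝ) / ε ^ 2 ≤ t) (Y : Indicator n k) :
    0.97 ≤ prob (signMatrix d t) {R | PreservesApproximation A (A * R) Y ε} := by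
  have hk0 : (0 : ℝ) < k := by exact_mod_cast hk
  have ht0 : (0 : ℝ) < t := lt_of_lt_of_le (by positivity) ht
  rw [div_le_iff₀ (by positivity)] at ht
  obtain ⟨V, hVk, hV⟩ := exists_submodule_row_mem A Y.1 Y.1ᵀ
  rw [prob_signMatrix]
  exact ((hasSubexponentialDistortion_sketch_scaledSignMatrix
      (by exact_mod_cast ht0)).le_prob_preservesProjectionCost hk hVk (row A) hV hε hε1
        (by linarith)).trans
    (prob_mono _ fun s => preservesApproximation_of_preservesProjectionCost)

lemma sub_le_prob_projectAndCluster {alg : Algorithm n t k} {γ δ q : ℝ}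
    (halg : IsApproximation alg γ δ) (hγ : 1 ≤ γ) (hδ : 0 ≤ δ) {A : Matrix (Fin n) (Fin d) ℝ}
    {Y : Indicator n k} {ε : ℝ}
    (hq : q ≤ prob (signMatrix d t) {R | PreservesApproximation A (A * R) Y ε}) :
    q - δ ≤ prob (projectAndCluster alg A) {X | cost A X ≤ (1 + (1 + ε) * γ) * cost A Y} := by
  have hle_one : prob (signMatrix d t) {R | PreservesApproximation A (A * R) Y ε} ≤ 1 :=
    (prob_mono _ (Set.subset_univ _)).trans_eq (prob_univ _)
  have hbind : (1 - δ) * prob (signMatrix d t) {R | PreservesApproximation A (A * R) Y ε} ≤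
      prob (projectAndCluster alg A) {X | cost A X ≤ (1 + (1 + ε) * γ) * cost A Y} :=
    mul_prob_le_prob_bind _ _ fun R (hR : PreservesApproximation A (A * R) Y ε) =>
      (halg (A * R)).trans (prob_mono _ fun X hX => hR γ hγ X (hX Y))
  nlinarith

end Clustering

end KMeansRP

open KMeansRP in
theorem theorem1_general :
    ∃ c : ℝ, 0 < c ∧
      ∀ (n d k : ℕ) (A : Matrix (Fin n) (Fin d) ℝ), 0 < k →
      ∀ ε : ℝ, 0 < ε → ε ≤ 1 →
      ∀ t : ℕ, c * (k : ℝ) / ε ^ 2 ≤ (t : ℝ) →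
        (∀ (γ δ : ℝ), 1 ≤ γ → 0 ≤ δ →
          ∀ alg : Algorithm n t k, IsApproximation alg γ δ →
          ∀ Y : Indicator n k,
            0.97 - δ ≤ prob (projectAndCluster alg A)
              {X | cost A X ≤ (1 + (1 + ε) * γ) * cost A Y}) ∧
        0.97 ≤ prob (signMatrix d t) {R | PreservesClustering k A (A * R) (2 + ε)} := by
  refine ⟨256 * 120000, by norm_num, fun n d k A hk ε hε hε1 t ht => ⟨?_, ?_⟩⟩
  · intro γ δ hγ hδ alg halg Y
    exact sub_le_prob_projectAndCluster halg hγ hδ (le_prob_preservesApproximation A hk hε hε1 ht Y)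
  · by_cases hopt : ∃ Y : Indicator n k, IsOptimal A Y
    · obtain ⟨Y, hY⟩ := hopt
      exact (le_prob_preservesApproximation A hk hε hε1 ht Y).trans
        (prob_mono _ fun R hR => hR.preservesClustering hε.le hY)
    · have hvacuous : {R : Matrix (Fin d) (Fin t) ℝ | PreservesClustering k A (A * R) (2 + ε)} =
          Set.univ :=
        Set.eq_univ_of_forall fun R X Xopt _ hXopt => absurd ⟨Xopt, hXopt⟩ hopt
      rw [hvacuous, prob_univ]
      norm_num

open KMeansRP in
theorem theorem1 :
    ∃ c : ℝ, 0 < c ∧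
      ∀ (n d k : ℕ) (A : Matrix (Fin n) (Fin d) ℝ), 0 < k → k < min n d →
      ∀ ε : ℝ, 0 < ε → ε < 1 / 3 →
      ∀ t : ℕ, c * (k : ℝ) / ε ^ 2 ≤ (t : ℝ) →
        (∀ (γ δ : ℝ), 1 ≤ γ → 0 ≤ δ → δ < 1 →
          ∀ alg : Algorithm n t k, IsApproximation alg γ δ →
          ∀ Xopt : Indicator n k, IsOptimal A Xopt →
            0.97 - δ ≤ prob (projectAndCluster alg A)
              {X | cost A X ≤ (1 + (1 + ε) * γ) * cost A Xopt}) ∧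
        0.97 ≤ prob (signMatrix d t) {R | PreservesClustering k A (A * R) (2 + ε)} := by
  obtain ⟨c, hc, h⟩ := theorem1_general
  exact ⟨c, hc, fun n d k A hk _ ε hε hε1 t ht =>
    ⟨fun γ δ hγ hδ _ alg halg Xopt _ => (h n d k A hk ε hε (by linarith) t ht).1 γ δ hγ hδ alg halg
      Xopt, (h n d k A hk ε hε (by linarith) t ht).2⟩⟩
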